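/- Let $\lambda>-1$ and $t>0$, and let $w(x)=w(x;t)=x^{\lambda}e^{-x^3-t/x}$ for $x\in(0,\infty)$. There is exactly one sequence $(P_n)_{n\ge 0}$ of monic real polynomials with $\deg P_n=n$ and $$\int_0^\infty P_m(x)P_n(x)w(x)\,dx=h_n\delta_{mn}\qquad (m,n\ge 0),$$ and it satisfies $h_n>0$ for all $n\ge 0$. Moreover, there are unique real sequences $(\alpha_n)_{n\ge0}$, $(\beta_n)_{n\ge0}$ with $\beta_0=0$ and $$xP_n(x)=P_{n+1}(x)+\alpha_nP_n(x)+\beta_nP_{n-1}(x)\qquad (n\ge 0),$$ where $P_{-1}=0$. Put $$R_n:=3(\alpha_n^2+\beta_n+\beta_{n+1}),\qquad r_n:=3(\alpha_n+\alpha_{n-1})\beta_n-n\qquad (n\ge 0),$$ with the convention $\alpha_{-1}=R_{-1}=r_{-1}=0$ (in the equations below, these quantities occur only in products with $\beta_0=0$). Then the recurrence coefficients satisfy the following system of nonlinear third-order difference equations for every $n\ge 0$: $$\begin{aligned} &\left[(r_n+r_{n+1}+\alpha_nR_n-\lambda)\beta_nR_{n-1}+(r_{n-1}+r_n+\alpha_{n-1}R_{n-1}-\lambda)\beta_nR_n+tr_n\right]\\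 &\times\left[(r_n+r_{n+1}+\alpha_nR_n-\lambda)\beta_nR_{n-1}+(r_{n-1}+r_n+\alpha_{n-1}R_{n-1}-\lambda)\beta_nR_n-tr_n+\lambda t\right]\\ &=\beta_n(2r_n-\lambda)^2(r_n+r_{n+1}+\alpha_nR_n-\lambda)(r_{n-1}+r_n+\alpha_{n-1}R_{n-1}-\lambda) \end{aligned}$$ and $$\begin{aligned} &2(r_n+r_{n+1}+\alpha_nR_n-\lambda)\beta_nR_{n-1}+2(r_{n-1}+r_n+\alpha_{n-1}R_{n-1}-\lambda)\beta_nR_n+2tr_n\\ &+(2r_n-\lambda)\left[\alpha_n(r_n+r_{n+1}+\alpha_nR_n-\lambda-1)+3\beta_n^2-3\beta_{n+1}^2-t\right]\\ &=(2r_n-\lambda)\left[\beta_n(3\alpha_n\alpha_{n-1}+R_n+R_{n-1})-\beta_{n+1}(3\alpha_{n+1}\alpha_n+R_{n+1}+R_n)\right]. \end{aligned}$$ -/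

import Mathlib

open Polynomial

/-- The singularly perturbed Airy weight `w(x; t) = x ^ lam * exp (-x ^ 3 - t / x)`; it is only
used for `x > 0`. -/
noncomputable def airyWeight (lam t x : ℝ) : ℝ :=
  x ^ lam * Real.exp (-x ^ 3 - t / x)

/-- The pairing `∫₀^∞ p(x) q(x) w(x; t) dx` of two real polynomials. -/
noncomputable def airyPairing (lam t : ℝ) (p q : ℝ[X]) : ℝ :=
  ∫ x in Set.Ioi (0 : ℝ), p.eval x * q.eval x * airyWeight lam t x

/-- `P 0, P 1, P 2, …` is the sequence of monic orthogonal polynomials for the weight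
`airyWeight lam t` on `(0, ∞)`: `P n` is monic of degree `n`, and
`∫₀^∞ P_m P_n w = 0` for `m ≠ n`. -/
structure IsMonicAiryOPS (lam t : ℝ) (P : ℕ → ℝ[X]) : Prop where
  monic : ∀ n, (P n).Monic
  natDegree_eq : ∀ n, (P n).natDegree = n
  orthogonal : ∀ m n, m ≠ n → airyPairing lam t (P m) (P n) = 0

/-- The sequence `n ↦ a (n - 1)`, with the convention `a (-1) = 0`. -/
def prevTerm {M : Type*} [Zero M] (a : ℕ → M) : ℕ → M
  | 0 => 0
  | n + 1 => a n

/-- `α` and `β` are the recurrence coefficients of the monic polynomials `P`: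
`x P_n = P_{n+1} + α_n P_n + β_n P_{n-1}` for all `n ≥ 0`, where `P_{-1} = 0` and `β_0 = 0`. -/
structure IsRecurrenceCoeffs (P : ℕ → ℝ[X]) (α β : ℕ → ℝ) : Prop where
  beta_zero : β 0 = 0
  recurrence : ∀ n, X * P n = P (n + 1) + C (α n) * P n + C (β n) * prevTerm P n

/-!
Let `w(x) = x ^ a exp (-x ^ 3 - t / x)`. Because `exp (-t / x)` vanishes to infinite order at `0`,
all the moments of `w`, `w / x` and `w / x ^ 2` are finite, and the only analytic input is the
Pearson-type relation `w' = (-3 x ^ 2 + a / x + t / x ^ 2) w` in integrated form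
(`airyFunctional_derivative`) together with positivity (`airyFunctional_mul_self_pos`).
Existence and uniqueness of the orthogonal polynomials and of their recurrence coefficients hold
for any positive functional (`IsMonicOPS.existsUnique`,
`IsMonicOPS.existsUnique_isRecurrenceCoeffs`).

For the difference equations, write `h n` for the squared norm of `P n`, and put
`S n = t ∫ P n ^ 2 w / x / h n` and `c n = t ∫ P n P (n - 1) w / x / h (n - 1)`. Integrating by
parts against `P n ^ 2`, `P n P (n - 1)`, `x P n ^ 2` and `x P n P (n - 1)` expresses the moments
of `w / x` and `w / x ^ 2` through the recurrence coefficients; in particular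
`S n = r n + r (n + 1) + α n R n - a` (`diagMoment`), and `c (n + 1) - c n` becomes a polynomial
in `α` and `β` (`crossMoment_sub`). Pairing the three-term recurrence with `P n / x` gives
`c (n + 1) + c n = t - α n S n` (`crossMoment_add`). Finally, in `∫ P m P n w / x` and
`∫ P m P n w / x ^ 2` one factor may be replaced by its Taylor polynomial at `0`, up to
terms controlled by orthogonality. This factorisation yields
* `c n (c n - t) = β n S n S (n - 1)` (`crossMoment_mul_sub`),
* `(2 r n - a) c n - t r n = β n (R n S (n - 1) + R (n - 1) S n)` (`two_mul_sub_mul_crossMoment`).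

Multiplying the first of these by `(2 r n - a) ^ 2` and eliminating `c n` with the second gives
the first difference equation. The second one is `2 c n`, computed from the sum and the difference
of `c (n + 1)` and `c n`, multiplied by `2 r n - a`; no division by `2 r n - a` is involved.
-/

/-! ### Integrability and integration by parts for the weight -/

lemma airyWeight_pos (a t : ℝ) {x : ℝ} (hx : 0 < x) : 0 < airyWeight a t x :=
  mul_pos (Real.rpow_pos_of_pos hx a) (Real.exp_pos _)

lemma pow_mul_airyWeight (a t : ℝ) (n : ℕ) {x : ℝ} (hx : 0 < x) :
    x ^ n * airyWeight a t x = airyWeight (a + n) t x := by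
  rw [airyWeight, airyWeight, Real.rpow_add hx, Real.rpow_natCast]
  ring

lemma continuousOn_airyWeight (a t : ℝ) : ContinuousOn (airyWeight a t) (Set.Ioi 0) := by
  intro x hx
  have hx0 : x ≠ 0 := (Set.mem_Ioi.mp hx).ne'
  unfold airyWeight
  exact ((Real.continuousAt_rpow_const x a (Or.inl hx0)).mul
    (by fun_prop (disch := assumption))).continuousWithinAt

/-- The factor `exp (-t / x)` vanishes to infinite order at `0`: it costs only a constant to
trade it for an arbitrary power of `x`. -/
lemma airyWeight_le (a : ℝ) {t : ℝ} (ht : 0 < t) (N : ℕ) {x : ℝ} (hx : 0 < x) :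
    airyWeight a t x ≤ (N.factorial / t ^ N) * (x ^ (a + N) * Real.exp (-x ^ 3)) := by
  have hfac : (0 : ℝ) < N.factorial := by exact_mod_cast N.factorial_pos
  have h := Real.pow_div_factorial_le_exp (x := t / x) (by positivity) N
  have hexp : Real.exp (-(t / x)) ≤ N.factorial / t ^ N * x ^ N := by
    rw [Real.exp_neg]
    calc (Real.exp (t / x))⁻¹ ≤ ((t / x) ^ N / N.factorial)⁻¹ := by gcongr
      _ = N.factorial / t ^ N * x ^ N := by rw [div_pow]; field_simp
  rw [airyWeight, sub_eq_add_neg, Real.exp_add, Real.rpow_add hx, Real.rpow_natCast]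
  calc x ^ a * (Real.exp (-x ^ 3) * Real.exp (-(t / x)))
      ≤ x ^ a * (Real.exp (-x ^ 3) * (N.factorial / t ^ N * x ^ N)) := by gcongr
    _ = _ := by ring

lemma integrableOn_airyWeight (a : ℝ) {t : ℝ} (ht : 0 < t) :
    MeasureTheory.IntegrableOn (airyWeight a t) (Set.Ioi 0) := by
  obtain ⟨N, hN⟩ := exists_nat_gt (-1 - a)
  have hint : MeasureTheory.IntegrableOn
      (fun x : ℝ => (N.factorial / t ^ N) * (x ^ (a + N) * Real.exp (-x ^ (3 : ℝ)))) (Set.Ioi 0) :=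
    (integrableOn_rpow_mul_exp_neg_rpow (by linarith) (by norm_num)).const_mul _
  refine hint.mono'
    ((continuousOn_airyWeight a t).aestronglyMeasurable measurableSet_Ioi) ?_
  refine (MeasureTheory.ae_restrict_mem measurableSet_Ioi).mono fun x hx => ?_
  have h3 : x ^ (3 : ℝ) = x ^ 3 := by exact_mod_cast Real.rpow_natCast x 3
  rw [Real.norm_of_nonneg (airyWeight_pos a t hx).le, h3]
  exact airyWeight_le a ht N hx

lemma tendsto_airyWeight_zero (a : ℝ) {t : ℝ} (ht : 0 < t) :
    Filter.Tendsto (airyWeight a t) (nhdsWithin 0 (Set.Ioi 0)) (nhds 0) := by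
  obtain ⟨N, hN⟩ := exists_nat_gt (-a)
  have hlim : Filter.Tendsto
      (fun x : ℝ => (N.factorial / t ^ N) * (x ^ (a + N) * Real.exp (-x ^ 3)))
      (nhdsWithin 0 (Set.Ioi 0)) (nhds 0) := by
    have hc : ContinuousAt
        (fun x : ℝ => (N.factorial / t ^ N) * (x ^ (a + N) * Real.exp (-x ^ 3))) 0 :=
      continuousAt_const.mul
        ((Real.continuousAt_rpow_const 0 (a + N) (Or.inr (by linarith))).mul (by fun_prop))
    have h := hc.tendsto
    rw [Real.zero_rpow (by linarith), zero_mul, mul_zero] at h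
    exact h.mono_left nhdsWithin_le_nhds
  refine squeeze_zero' ?_ ?_ hlim
  · filter_upwards [self_mem_nhdsWithin] with x hx using (airyWeight_pos a t hx).le
  · filter_upwards [self_mem_nhdsWithin] with x hx using airyWeight_le a ht N hx

/-- The derivative of the weight, written in terms of shifted weights. -/
lemma hasDerivAt_airyWeight (a t : ℝ) {x : ℝ} (hx : 0 < x) :
    HasDerivAt (airyWeight a t)
      (a * airyWeight (a - 1) t x - 3 * airyWeight (a + 2) t x + t * airyWeight (a - 2) t x) x := by
  have h1 : HasDerivAt (fun y : ℝ => y ^ a) (a * x ^ (a - 1)) x :=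
    Real.hasDerivAt_rpow_const (Or.inl hx.ne')
  have h2 : HasDerivAt (fun y : ℝ => -y ^ 3 - t / y) (-(3 * x ^ 2) + t / x ^ 2) x := by
    have h := ((hasDerivAt_pow 3 x).neg).sub ((hasDerivAt_inv hx.ne').const_mul t)
    refine h.congr_deriv ?_
    simp only [Nat.cast_ofNat]
    ring
  refine (h1.mul h2.exp).congr_deriv ?_
  have e1 : x ^ (a + 2) = x ^ a * x ^ 2 := by
    rw [Real.rpow_add hx]; norm_cast
  have e2 : x ^ (a - 2) = x ^ a / x ^ 2 := by
    rw [Real.rpow_sub hx]; norm_cast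
  simp only [airyWeight, e1, e2]
  ring

lemma integral_airyWeight_byParts (a : ℝ) {t : ℝ} (ht : 0 < t) :
    a * (∫ x in Set.Ioi (0 : ℝ), airyWeight (a - 1) t x)
      - 3 * (∫ x in Set.Ioi (0 : ℝ), airyWeight (a + 2) t x)
      + t * (∫ x in Set.Ioi (0 : ℝ), airyWeight (a - 2) t x) = 0 := by
  have i1 := (integrableOn_airyWeight (a - 1) ht).const_mul a
  have i2 := (integrableOn_airyWeight (a + 2) ht).const_mul 3
  have i3 := (integrableOn_airyWeight (a - 2) ht).const_mul t
  have hint : MeasureTheory.IntegrableOn (fun x => a * airyWeight (a - 1) t x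
      - 3 * airyWeight (a + 2) t x + t * airyWeight (a - 2) t x) (Set.Ioi 0) :=
    (i1.sub i2).add i3
  have hderiv : ∀ x ∈ Set.Ioi (0 : ℝ), HasDerivAt (airyWeight a t)
      (a * airyWeight (a - 1) t x - 3 * airyWeight (a + 2) t x + t * airyWeight (a - 2) t x) x :=
    fun x hx => hasDerivAt_airyWeight a t hx
  have hinfty := MeasureTheory.tendsto_zero_of_hasDerivAt_of_integrableOn_Ioi hderiv hint
    (integrableOn_airyWeight a ht)
  have key := MeasureTheory.integral_Ioi_deriv_mul_eq_sub (v := fun _ => (1 : ℝ))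
    (v' := fun _ => (0 : ℝ)) (a' := 0) (b' := 0) hderiv (fun x _ => hasDerivAt_const x (1 : ℝ))
    (hint.congr_fun (fun x _ => by simp) measurableSet_Ioi)
    (by convert tendsto_airyWeight_zero a ht using 1; ext x; simp)
    (by convert hinfty using 1; ext x; simp)
  simp only [mul_one, mul_zero, add_zero, sub_zero] at key
  have hadd : (∫ x in Set.Ioi (0 : ℝ), (a * airyWeight (a - 1) t x - 3 * airyWeight (a + 2) t x
      + t * airyWeight (a - 2) t x))
      = (∫ x in Set.Ioi (0 : ℝ), (a * airyWeight (a - 1) t x - 3 * airyWeight (a + 2) t x))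
        + ∫ x in Set.Ioi (0 : ℝ), t * airyWeight (a - 2) t x :=
    MeasureTheory.integral_add (i1.sub i2) i3
  rw [hadd, MeasureTheory.integral_sub i1 i2] at key
  simpa only [MeasureTheory.integral_const_mul] using key

/-! ### The moment functionals -/

lemma eval_monomial_mul_airyWeight (a t : ℝ) (n : ℕ) (c : ℝ) {x : ℝ} (hx : 0 < x) :
    (monomial n c).eval x * airyWeight a t x = c * airyWeight (a + n) t x := by
  rw [eval_monomial, mul_assoc, pow_mul_airyWeight a t n hx]

lemma integrableOn_eval_mul_airyWeight (a : ℝ) {t : ℝ} (ht : 0 < t) (p : ℝ[X]) :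
    MeasureTheory.IntegrableOn (fun x => p.eval x * airyWeight a t x) (Set.Ioi 0) := by
  induction p using Polynomial.induction_on' with
  | add p q hp hq =>
    simp only [eval_add, add_mul]
    exact hp.add hq
  | monomial n c =>
    have h : MeasureTheory.IntegrableOn (fun x => c * airyWeight (a + n) t x) (Set.Ioi 0) :=
      (integrableOn_airyWeight (a + n) ht).const_mul c
    refine h.congr_fun (fun x hx => ?_) measurableSet_Ioi
    exact (eval_monomial_mul_airyWeight a t n c hx).symm

/-- The linear functional `p ↦ ∫₀^∞ p(x) x ^ a exp (-x ^ 3 - t / x) dx` on real polynomials. The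
exponent `a` is an arbitrary real number, so that dividing the weight by `x` is the shift
`a ↦ a - 1`. -/
noncomputable def airyFunctional (a : ℝ) {t : ℝ} (ht : 0 < t) : ℝ[X] →ₗ[ℝ] ℝ where
  toFun p := ∫ x in Set.Ioi (0 : ℝ), p.eval x * airyWeight a t x
  map_add' p q := by
    simp only [eval_add, add_mul]
    exact MeasureTheory.integral_add (integrableOn_eval_mul_airyWeight a ht p)
      (integrableOn_eval_mul_airyWeight a ht q)
  map_smul' c p := by
    simp only [eval_smul, smul_eq_mul, mul_assoc, MeasureTheory.integral_const_mul,
      RingHom.id_apply]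

lemma airyPairing_eq (a : ℝ) {t : ℝ} (ht : 0 < t) (p q : ℝ[X]) :
    airyPairing a t p q = airyFunctional a ht (p * q) := by
  simp only [airyPairing, airyFunctional, LinearMap.coe_mk, AddHom.coe_mk, eval_mul]

lemma airyFunctional_X_mul (a : ℝ) {t : ℝ} (ht : 0 < t) (p : ℝ[X]) :
    airyFunctional a ht (X * p) = airyFunctional (a + 1) ht p := by
  refine MeasureTheory.setIntegral_congr_fun measurableSet_Ioi fun x hx => ?_
  have h := pow_mul_airyWeight a t 1 hx
  simp only [pow_one, Nat.cast_one] at h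
  simp only [eval_mul, eval_X, ← h]
  ring

lemma airyFunctional_monomial (a : ℝ) {t : ℝ} (ht : 0 < t) (n : ℕ) (c : ℝ) :
    airyFunctional a ht (monomial n c)
      = c * ∫ x in Set.Ioi (0 : ℝ), airyWeight (a + n) t x := by
  rw [← MeasureTheory.integral_const_mul]
  exact MeasureTheory.setIntegral_congr_fun measurableSet_Ioi
    fun x hx => eval_monomial_mul_airyWeight a t n c hx

/-- Integration by parts: the Pearson-type relation `w' = (-3x² + a/x + t/x²) w`. -/
lemma airyFunctional_derivative (a : ℝ) {t : ℝ} (ht : 0 < t) (p : ℝ[X]) :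
    airyFunctional a ht (derivative p) = 3 * airyFunctional a ht (X ^ 2 * p)
      - a * airyFunctional (a - 1) ht p - t * airyFunctional (a - 2) ht p := by
  induction p using Polynomial.induction_on' with
  | add p q hp hq => simp only [map_add, mul_add, hp, hq]; ring
  | monomial n c =>
    have hd : airyFunctional a ht (derivative (monomial n c))
        = c * (n * ∫ x in Set.Ioi (0 : ℝ), airyWeight (a + n - 1) t x) := by
      rcases n with _ | n
      · simp
      · rw [derivative_monomial, airyFunctional_monomial]
        simp only [Nat.cast_add, Nat.cast_one, add_tsub_cancel_right, ← add_assoc]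
        ring
    have h2 : (X : ℝ[X]) ^ 2 * monomial n c = monomial (n + 2) c := by
      rw [X_pow_mul_monomial]
    have key := integral_airyWeight_byParts (a + n) ht
    rw [hd, h2, airyFunctional_monomial, airyFunctional_monomial, airyFunctional_monomial]
    have s1 : a - 1 + n = a + n - 1 := by ring
    have s2 : a - 2 + n = a + n - 2 := by ring
    have s3 : a + ((n + 2 : ℕ) : ℝ) = a + n + 2 := by push_cast; ring
    rw [s1, s2, s3]
    linear_combination c * key

lemma airyFunctional_mul_self_pos (a : ℝ) {t : ℝ} (ht : 0 < t) {p : ℝ[X]} (hp : p ≠ 0) :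
    0 < airyFunctional a ht (p * p) := by
  have hnn : ∀ x ∈ Set.Ioi (0 : ℝ), 0 ≤ (p * p).eval x * airyWeight a t x := fun x hx => by
    rw [eval_mul]
    exact mul_nonneg (mul_self_nonneg _) (airyWeight_pos a t hx).le
  refine (MeasureTheory.setIntegral_pos_iff_support_of_nonneg_ae
    ((MeasureTheory.ae_restrict_mem measurableSet_Ioi).mono hnn)
    (integrableOn_eval_mul_airyWeight a ht (p * p))).mpr ?_
  -- The integrand vanishes on `(0, ∞)` only at the finitely many roots of `p`.
  have hsub : Set.Ioi (0 : ℝ) \ {x | p.IsRoot x}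
      ⊆ Function.support (fun x => (p * p).eval x * airyWeight a t x) ∩ Set.Ioi 0 := by
    rintro x ⟨hx, hr⟩
    refine ⟨?_, hx⟩
    rw [Function.mem_support, eval_mul]
    exact mul_ne_zero (mul_ne_zero hr hr) (airyWeight_pos a t hx).ne'
  refine lt_of_lt_of_le ?_ (MeasureTheory.measure_mono hsub)
  rw [MeasureTheory.measure_sdiff_null ((finite_setOfPred_isRoot hp).measure_zero _)]
  simp

/-! ### Monic orthogonal polynomials for a positive functional -/

/-- A sequence of monic polynomials, `P n` of degree `n`, that are pairwise orthogonal for the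
bilinear form `(p, q) ↦ L (p * q)` of a linear functional `L` on `ℝ[X]`. -/
structure IsMonicOPS (L : ℝ[X] →ₗ[ℝ] ℝ) (P : ℕ → ℝ[X]) : Prop where
  monic : ∀ n, (P n).Monic
  natDegree_eq : ∀ n, (P n).natDegree = n
  orthogonal : ∀ m n, m ≠ n → L (P m * P n) = 0

lemma map_C_mul (L : ℝ[X] →ₗ[ℝ] ℝ) (c : ℝ) (p : ℝ[X]) : L (C c * p) = c * L p := by
  rw [← smul_eq_C_mul, map_smul, smul_eq_mul]

/-- Existence of one orthogonal polynomial: `q ↦ L (q * ·)` is an injective endomorphism from the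
polynomials of degree `< n` to their dual, hence surjective, so that `X ^ n` can be corrected by a
polynomial of degree `< n`. -/
lemma exists_monic_orthogonal {L : ℝ[X] →ₗ[ℝ] ℝ} (hpos : ∀ p ≠ 0, 0 < L (p * p)) (n : ℕ) :
    ∃ p : ℝ[X], p.Monic ∧ p.natDegree = n ∧ ∀ q : ℝ[X], q.degree < n → L (p * q) = 0 := by
  let V := degreeLT ℝ n
  let B : V →ₗ[ℝ] Module.Dual ℝ V := ((LinearMap.mul ℝ ℝ[X]).compr₂ L).domRestrict₁₂ V V
  have hB : ∀ u v : V, B u v = L ((u : ℝ[X]) * v) := fun u v => rfl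
  have : FiniteDimensional ℝ V := Module.Finite.equiv (degreeLTEquiv ℝ n).symm
  have hinj : Function.Injective B := by
    rw [← LinearMap.ker_eq_bot, LinearMap.ker_eq_bot']
    intro u hu
    by_contra hne
    have h := hpos (u : ℝ[X]) (fun h0 => hne (Subtype.ext h0))
    rw [← hB, hu] at h
    exact lt_irrefl _ h
  have hsurj : Function.Surjective B :=
    (LinearMap.injective_iff_surjective_of_finrank_eq_finrank
      (Subspace.dual_finrank_eq).symm).mp hinj
  obtain ⟨u, hu⟩ := hsurj (((LinearMap.mul ℝ ℝ[X]).compr₂ L (X ^ n)).comp V.subtype)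
  have hdeg : (u : ℝ[X]).degree < n := mem_degreeLT.mp u.2
  refine ⟨X ^ n - (u : ℝ[X]), monic_X_pow_sub hdeg, ?_, fun q hq => ?_⟩
  · refine natDegree_eq_of_degree_eq_some ?_
    rw [degree_sub_eq_left_of_degree_lt (by rwa [degree_X_pow]), degree_X_pow]
  · have h := LinearMap.congr_fun hu ⟨q, mem_degreeLT.mpr hq⟩
    rw [hB] at h
    simp only [LinearMap.comp_apply, LinearMap.compr₂_apply, LinearMap.mul_apply',
      Submodule.subtype_apply] at h
    rw [sub_mul, map_sub, h, sub_self]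

namespace IsMonicOPS

variable {L : ℝ[X] →ₗ[ℝ] ℝ} {P : ℕ → ℝ[X]}

lemma degree_eq (hP : IsMonicOPS L P) (n : ℕ) : (P n).degree = n := by
  rw [degree_eq_natDegree (hP.monic n).ne_zero, hP.natDegree_eq]

lemma coeff_self (hP : IsMonicOPS L P) (n : ℕ) : (P n).coeff n = 1 := by
  have h := (hP.monic n).coeff_natDegree
  rwa [hP.natDegree_eq] at h

lemma norm_pos (hP : IsMonicOPS L P) (hpos : ∀ p ≠ 0, 0 < L (p * p)) (n : ℕ) :
    0 < L (P n * P n) :=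
  hpos _ (hP.monic n).ne_zero

/-- The first `n` orthogonal polynomials span the polynomials of degree `< n`. -/
lemma map_mul_eq_zero_of_forall_lt (hP : IsMonicOPS L P) {n : ℕ} {p : ℝ[X]}
    (h : ∀ k < n, L (p * P k) = 0) {q : ℝ[X]} (hq : q.degree < n) : L (p * q) = 0 := by
  let S : Polynomial.Sequence ℝ := ⟨P, hP.degree_eq⟩
  have hspan := S.span_degreeLT (m := n) fun i _ => by
    have : (S i).leadingCoeff = 1 := hP.monic i
    rw [this]
    exact isUnit_one
  have hle : Submodule.span ℝ (S '' Set.Iio n)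
      ≤ LinearMap.ker ((LinearMap.mul ℝ ℝ[X]).compr₂ L p) := by
    rw [Submodule.span_le]
    rintro _ ⟨k, hk, rfl⟩
    exact h k hk
  rw [hspan] at hle
  exact hle (mem_degreeLT.mpr hq)

lemma map_mul_eq_zero (hP : IsMonicOPS L P) {n : ℕ} {q : ℝ[X]} (hq : q.degree < n) :
    L (P n * q) = 0 :=
  hP.map_mul_eq_zero_of_forall_lt (fun k hk => hP.orthogonal n k hk.ne') hq

lemma eq_zero_of_forall_lt (hP : IsMonicOPS L P) (hpos : ∀ p ≠ 0, 0 < L (p * p)) {n : ℕ}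
    {p : ℝ[X]} (hp : p.degree < n) (h : ∀ k < n, L (p * P k) = 0) : p = 0 := by
  by_contra hne
  exact (hpos p hne).ne' (hP.map_mul_eq_zero_of_forall_lt h hp)

/-- Against `P n`, a polynomial of degree at most `n` only counts through its coefficient of
degree `n`. -/
lemma map_mul_of_degree_le (hP : IsMonicOPS L P) {n : ℕ} {q : ℝ[X]} (hq : q.natDegree ≤ n) :
    L (P n * q) = q.coeff n * L (P n * P n) := by
  have hd : (q - C (q.coeff n) * P n).degree < n := by
    rw [degree_lt_iff_coeff_zero]
    intro m hm
    rcases hm.eq_or_lt with rfl | hlt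
    · simp [hP.coeff_self]
    · have h0 : (P n).coeff m = 0 :=
        coeff_eq_zero_of_natDegree_lt (by rwa [hP.natDegree_eq])
      rw [coeff_sub, coeff_C_mul, coeff_eq_zero_of_natDegree_lt (hq.trans_lt hlt), h0, mul_zero,
        sub_zero]
  have h := hP.map_mul_eq_zero hd
  have e : P n * (q - C (q.coeff n) * P n) = P n * q - C (q.coeff n) * (P n * P n) := by ring
  rw [e, map_sub, map_C_mul] at h
  linarith

lemma existsUnique (hpos : ∀ p ≠ 0, 0 < L (p * p)) : ∃! P : ℕ → ℝ[X], IsMonicOPS L P := by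
  choose P hmonic hdeg horth using exists_monic_orthogonal hpos
  have hlt : ∀ {m n : ℕ}, m < n → (P m).degree < n := fun {m n} h => by
    rw [degree_eq_natDegree (hmonic m).ne_zero, hdeg]
    exact_mod_cast h
  have hP : IsMonicOPS L P := by
    refine ⟨hmonic, hdeg, fun m n hmn => ?_⟩
    rcases hmn.lt_or_gt with h | h
    · rw [mul_comm]
      exact horth n _ (hlt h)
    · exact horth m _ (hlt h)
  refine ⟨P, hP, fun Q hQ => funext fun n => ?_⟩
  have hd : (Q n - P n).degree < n := by
    have h := degree_sub_lt_left ((hQ.degree_eq n).trans (hP.degree_eq n).symm)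
      (hQ.monic n).ne_zero ((hQ.monic n).leadingCoeff.trans (hP.monic n).leadingCoeff.symm)
    rwa [hQ.degree_eq] at h
  refine sub_eq_zero.mp (hP.eq_zero_of_forall_lt hpos hd fun k hk => ?_)
  rw [sub_mul, map_sub, hQ.map_mul_eq_zero (hlt hk), hP.map_mul_eq_zero (hlt hk), sub_zero]

/-! ### The three-term recurrence -/

lemma map_mul_prevTerm (hP : IsMonicOPS L P) {m n : ℕ} (h : n ≤ m) :
    L (P m * prevTerm P n) = 0 := by
  rcases n with _ | n
  · simp [prevTerm]
  · exact hP.orthogonal _ _ (Nat.lt_of_succ_le h).ne'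

/-- Pairing the recurrence with `P n` determines `α n`. -/
lemma alpha_mul_norm (hP : IsMonicOPS L P) {α β : ℕ → ℝ} (h : IsRecurrenceCoeffs P α β) (n : ℕ) :
    α n * L (P n * P n) = L (X * P n * P n) := by
  rw [h.recurrence n, add_mul, add_mul, map_add, map_add, mul_assoc, mul_assoc, map_C_mul,
    map_C_mul, hP.orthogonal _ _ n.succ_ne_self, mul_comm (prevTerm P n),
    hP.map_mul_prevTerm le_rfl]
  ring

/-- Pairing the recurrence with `P (n - 1)` determines `β n`. -/
lemma beta_mul_norm (hP : IsMonicOPS L P) {α β : ℕ → ℝ} (h : IsRecurrenceCoeffs P α β) (n : ℕ) :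
    β (n + 1) * L (P n * P n) = L (P (n + 1) * P (n + 1)) := by
  have h1 : L (P (n + 1) * (X * P n)) = L (P (n + 1) * P (n + 1)) := by
    rw [h.recurrence n, mul_add, mul_add, map_add, map_add, mul_left_comm, map_C_mul,
      mul_left_comm, map_C_mul, hP.orthogonal _ _ n.succ_ne_self,
      hP.map_mul_prevTerm n.le_succ]
    ring
  have h2 : P (n + 1) * (X * P n) = X * P (n + 1) * P n := by ring
  rw [← h1, h2, h.recurrence (n + 1), add_mul, add_mul, map_add, map_add, mul_assoc, mul_assoc,
    map_C_mul, map_C_mul, hP.orthogonal _ _ n.succ_ne_self,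
    hP.orthogonal _ _ (show n + 1 + 1 ≠ n by omega)]
  simp only [prevTerm]
  ring

lemma exists_isRecurrenceCoeffs (hP : IsMonicOPS L P) (hpos : ∀ p ≠ 0, 0 < L (p * p)) :
    ∃ α β : ℕ → ℝ, IsRecurrenceCoeffs P α β := by
  have hne : ∀ n, L (P n * P n) ≠ 0 := fun n => (hP.norm_pos hpos n).ne'
  let α : ℕ → ℝ := fun n => L (X * P n * P n) / L (P n * P n)
  let β : ℕ → ℝ := prevTerm fun n => L (P (n + 1) * P (n + 1)) / L (P n * P n)
  refine ⟨α, β, rfl, fun n => ?_⟩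
  have hXdeg : (X * P n).degree = ((n + 1 : ℕ) : WithBot ℕ) := by
    rw [degree_mul, degree_X, hP.degree_eq, add_comm]; rfl
  have hprev : (prevTerm P n).degree < ((n + 1 : ℕ) : WithBot ℕ) := by
    rcases n with _ | n
    · simp [prevTerm]
    · rw [prevTerm, hP.degree_eq]; exact_mod_cast (by omega)
  have hd1 : (X * P n - P (n + 1)).degree < ((n + 1 : ℕ) : WithBot ℕ) := by
    have h := degree_sub_lt_left (hXdeg.trans (hP.degree_eq (n + 1)).symm)
      (mul_ne_zero X_ne_zero (hP.monic n).ne_zero)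
      ((monic_X.mul (hP.monic n)).leadingCoeff.trans (hP.monic (n + 1)).leadingCoeff.symm)
    rwa [hXdeg] at h
  have hC : ∀ (c : ℝ) {p : ℝ[X]}, p.degree < ((n + 1 : ℕ) : WithBot ℕ) →
      (C c * p).degree < ((n + 1 : ℕ) : WithBot ℕ) := fun c p hp => by
    rw [← smul_eq_C_mul]
    exact (degree_smul_le c p).trans_lt hp
  have hd2 : (C (α n) * P n).degree < ((n + 1 : ℕ) : WithBot ℕ) :=
    hC _ (by rw [hP.degree_eq]; exact_mod_cast n.lt_succ_self)
  have hd3 : (C (β n) * prevTerm P n).degree < ((n + 1 : ℕ) : WithBot ℕ) :=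
    hC _ hprev
  have hd : (X * P n - P (n + 1) - C (α n) * P n - C (β n) * prevTerm P n).degree
      < ((n + 1 : ℕ) : WithBot ℕ) :=
    (degree_sub_le _ _).trans_lt (max_lt ((degree_sub_le _ _).trans_lt (max_lt hd1 hd2)) hd3)
  have hzero := hP.eq_zero_of_forall_lt hpos hd fun k hk => ?_
  · linear_combination hzero
  have e : (X * P n - P (n + 1) - C (α n) * P n - C (β n) * prevTerm P n) * P k
      = P n * (X * P k) - P (n + 1) * P k - C (α n) * (P n * P k)
        - C (β n) * (P k * prevTerm P n) := by ring
  rw [e, map_sub, map_sub, map_sub, map_C_mul, map_C_mul, hP.orthogonal (n + 1) k (by omega)]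
  rcases (Nat.lt_succ_iff.mp hk).eq_or_lt with rfl | hkn
  · rw [hP.map_mul_prevTerm le_rfl]
    have : P k * (X * P k) = X * P k * P k := by ring
    rw [this]
    simp only [α]
    field_simp [hne k]
    ring
  · obtain ⟨n, rfl⟩ : ∃ m, n = m + 1 := ⟨n - 1, by omega⟩
    rw [hP.orthogonal (n + 1) k (by omega)]
    simp only [prevTerm, β]
    have hXk : (X * P k).natDegree = k + 1 := by
      rw [natDegree_X_mul (hP.monic k).ne_zero, hP.natDegree_eq]
    rw [hP.map_mul_of_degree_le (by omega), coeff_X_mul]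
    rcases (Nat.lt_succ_iff.mp hkn).eq_or_lt with rfl | hlt
    · rw [hP.coeff_self, div_mul_cancel₀ _ (hne k)]
      ring
    · rw [hP.orthogonal k n hlt.ne,
        coeff_eq_zero_of_natDegree_lt (by rw [hP.natDegree_eq]; exact hlt)]
      ring

lemma existsUnique_isRecurrenceCoeffs (hP : IsMonicOPS L P) (hpos : ∀ p ≠ 0, 0 < L (p * p)) :
    ∃! c : (ℕ → ℝ) × (ℕ → ℝ), IsRecurrenceCoeffs P c.1 c.2 := by
  obtain ⟨α, β, h⟩ := hP.exists_isRecurrenceCoeffs hpos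
  refine ⟨(α, β), h, fun c hc => Prod.ext (funext fun n => ?_) (funext fun n => ?_)⟩
  · exact mul_right_cancel₀ (hP.norm_pos hpos n).ne'
      ((hP.alpha_mul_norm hc n).trans (hP.alpha_mul_norm h n).symm)
  · rcases n with _ | n
    · exact hc.beta_zero.trans h.beta_zero.symm
    · exact mul_right_cancel₀ (hP.norm_pos hpos n).ne'
        ((hP.beta_mul_norm hc n).trans (hP.beta_mul_norm h n).symm)

end IsMonicOPS

namespace IsMonicOPS

variable {L : ℝ[X] →ₗ[ℝ] ℝ} {P : ℕ → ℝ[X]} {α β : ℕ → ℝ}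

/-! ### Matrix elements of multiplication by powers of `X` -/

lemma map_mul_recurrence (L : ℝ[X] →ₗ[ℝ] ℝ) (h : IsRecurrenceCoeffs P α β) (q : ℝ[X]) (n : ℕ) :
    L (q * (X * P n)) = L (q * P (n + 1)) + α n * L (q * P n) + β n * L (q * prevTerm P n) := by
  have e : q * (X * P n) = q * P (n + 1) + C (α n) * (q * P n) + C (β n) * (q * prevTerm P n) := by
    rw [h.recurrence n]; ring
  rw [e, map_add, map_add, map_C_mul, map_C_mul]

lemma map_mul_X_pow_mul (hP : IsMonicOPS L P) (n k : ℕ) :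
    L (P (n + k) * (X ^ k * P n)) = L (P (n + k) * P (n + k)) := by
  have hd : (X ^ k * P n).natDegree = n + k := by
    rw [(monic_X_pow k).natDegree_mul (hP.monic n), natDegree_X_pow, hP.natDegree_eq, add_comm]
  rw [hP.map_mul_of_degree_le hd.le, coeff_X_pow_mul, hP.coeff_self, one_mul]

lemma map_X_mul_succ (hP : IsMonicOPS L P) (n : ℕ) :
    L (X * P (n + 1) * P n) = L (P (n + 1) * P (n + 1)) := by
  have e : X * P (n + 1) * P n = P (n + 1) * (X ^ 1 * P n) := by ring
  rw [e, hP.map_mul_X_pow_mul]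

lemma map_X_sq_mul_self (hP : IsMonicOPS L P) (h : IsRecurrenceCoeffs P α β) (n : ℕ) :
    L (X ^ 2 * (P n * P n)) = (α n ^ 2 + β n + β (n + 1)) * L (P n * P n) := by
  have e : X ^ 2 * (P n * P n) = X * P n * (X * P n) := by ring
  have e1 : X * P n * P (n + 1) = X * P (n + 1) * P n := by ring
  have hprev : β n * L (X * P n * prevTerm P n) = β n * L (P n * P n) := by
    rcases n with _ | n
    · rw [h.beta_zero, zero_mul, zero_mul]
    · rw [prevTerm, hP.map_X_mul_succ]
  rw [e, map_mul_recurrence L h, e1, hP.map_X_mul_succ, hprev, ← hP.alpha_mul_norm h,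
    ← hP.beta_mul_norm h]
  ring

lemma map_X_sq_mul_succ (hP : IsMonicOPS L P) (h : IsRecurrenceCoeffs P α β) (n : ℕ) :
    L (X ^ 2 * (P (n + 1) * P n)) = (α (n + 1) + α n) * L (P (n + 1) * P (n + 1)) := by
  have e : X ^ 2 * (P (n + 1) * P n) = X * P (n + 1) * (X * P n) := by ring
  have hprev : β n * L (X * P (n + 1) * prevTerm P n) = 0 := by
    rcases n with _ | n
    · rw [h.beta_zero, zero_mul]
    · have e2 : X * P (n + 1 + 1) * P n = P (n + 2) * (X * P n) := by ring
      have hX : (X * P n).degree < ((n + 2 : ℕ) : WithBot ℕ) := by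
        rw [degree_mul, degree_X, hP.degree_eq]
        exact_mod_cast (by omega)
      rw [prevTerm, e2, hP.map_mul_eq_zero hX, mul_zero]
  rw [e, map_mul_recurrence L h, hprev, ← hP.alpha_mul_norm h, hP.map_X_mul_succ]
  ring

lemma map_X_cube_mul_self (hP : IsMonicOPS L P) (h : IsRecurrenceCoeffs P α β) (n : ℕ) :
    L (X ^ 3 * (P n * P n)) = (α n * (α n ^ 2 + β n + β (n + 1))
      + (α n + prevTerm α n) * β n + (α (n + 1) + α n) * β (n + 1)) * L (P n * P n) := by
  have e : X ^ 3 * (P n * P n) = X ^ 2 * P n * (X * P n) := by ring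
  have e1 : X ^ 2 * P n * P (n + 1) = X ^ 2 * (P (n + 1) * P n) := by ring
  have hprev : β n * L (X ^ 2 * P n * prevTerm P n)
      = β n * ((α n + prevTerm α n) * L (P n * P n)) := by
    rcases n with _ | n
    · rw [h.beta_zero, zero_mul, zero_mul]
    · rw [prevTerm, prevTerm, mul_assoc, hP.map_X_sq_mul_succ h]
  rw [e, map_mul_recurrence L h, e1, hP.map_X_sq_mul_succ h, hprev, mul_assoc (X ^ 2),
    hP.map_X_sq_mul_self h, ← hP.beta_mul_norm h]
  ring

lemma map_X_cube_mul_succ (hP : IsMonicOPS L P) (h : IsRecurrenceCoeffs P α β) (n : ℕ) :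
    L (X ^ 3 * (P (n + 1) * P n)) = (α (n + 1) ^ 2 + α (n + 1) * α n + α n ^ 2
      + β (n + 2) + β (n + 1) + β n) * L (P (n + 1) * P (n + 1)) := by
  have e : X ^ 3 * (P (n + 1) * P n) = X ^ 2 * P (n + 1) * (X * P n) := by ring
  have hprev : β n * L (X ^ 2 * P (n + 1) * prevTerm P n)
      = β n * L (P (n + 1) * P (n + 1)) := by
    rcases n with _ | n
    · rw [h.beta_zero, zero_mul, zero_mul]
    · have e2 : X ^ 2 * P (n + 1 + 1) * P n = P (n + 2) * (X ^ 2 * P n) := by ring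
      rw [prevTerm, e2, hP.map_mul_X_pow_mul]
  rw [e, map_mul_recurrence L h, hprev, mul_assoc (X ^ 2), mul_assoc (X ^ 2),
    hP.map_X_sq_mul_self h, hP.map_X_sq_mul_succ h]
  ring

/-- The subleading coefficients of the `P n` telescope the `α n`. -/
lemma coeff_succ_sub (hP : IsMonicOPS L P) (h : IsRecurrenceCoeffs P α β) (n : ℕ) :
    (P (n + 2)).coeff (n + 1) = (P (n + 1)).coeff n - α (n + 1) := by
  have hr := congrArg (fun p : ℝ[X] => p.coeff (n + 1)) (h.recurrence (n + 1))
  have h0 : (P n).coeff (n + 1) = 0 :=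
    coeff_eq_zero_of_natDegree_lt (by rw [hP.natDegree_eq]; exact n.lt_succ_self)
  simp only [coeff_X_mul, coeff_add, coeff_C_mul, prevTerm, hP.coeff_self, h0] at hr
  linarith

lemma coeff_one_zero (hP : IsMonicOPS L P) (h : IsRecurrenceCoeffs P α β) :
    (P 1).coeff 0 = -α 0 := by
  have hr := congrArg (fun p : ℝ[X] => p.coeff 0) (h.recurrence 0)
  simp only [coeff_X_mul_zero, coeff_add, coeff_C_mul, prevTerm, hP.coeff_self, coeff_zero,
    zero_add] at hr
  linarith

/-! ### Pairings with derivatives and with truncations -/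

lemma map_mul_derivative_self (hP : IsMonicOPS L P) (n : ℕ) :
    L (P n * derivative (P n)) = 0 := by
  have h := degree_derivative_lt (hP.monic n).ne_zero
  rw [hP.degree_eq] at h
  exact hP.map_mul_eq_zero h

lemma map_mul_derivative_succ (hP : IsMonicOPS L P) (n : ℕ) :
    L (P n * derivative (P (n + 1))) = (n + 1) * L (P n * P n) := by
  have hd : (derivative (P (n + 1))).natDegree ≤ n := by
    have h := natDegree_derivative_le (P (n + 1))
    rwa [hP.natDegree_eq] at h
  rw [hP.map_mul_of_degree_le hd, coeff_derivative, hP.coeff_self, one_mul]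

lemma map_mul_X_mul_derivative_self (hP : IsMonicOPS L P) (n : ℕ) :
    L (P n * (X * derivative (P n))) = n * L (P n * P n) := by
  have hd : (X * derivative (P n)).natDegree ≤ n := by
    rcases n with _ | n
    · rw [eq_C_of_natDegree_eq_zero (hP.natDegree_eq 0)]
      simp
    · have h := natDegree_derivative_le (P (n + 1))
      rw [hP.natDegree_eq] at h
      exact natDegree_mul_le.trans (by rw [natDegree_X]; omega)
  rw [hP.map_mul_of_degree_le hd]
  rcases n with _ | n
  · simp
  · rw [coeff_X_mul, coeff_derivative, hP.coeff_self]
    push_cast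
    ring

/-- The Euler operator `X d/dX` acts on `P (n + 1)` as multiplication by `n + 1` up to a
polynomial of degree `n`, whose leading coefficient is minus the subleading one of `P (n + 1)`. -/
lemma map_mul_X_mul_derivative_succ (hP : IsMonicOPS L P) (n : ℕ) :
    L (P n * (X * derivative (P (n + 1)))) = -(P (n + 1)).coeff n * L (P n * P n) := by
  have hc : ∀ m, (X * derivative (P (n + 1))).coeff m = m * (P (n + 1)).coeff m := by
    rintro (_ | m)
    · simp
    · rw [coeff_X_mul, coeff_derivative]
      push_cast
      ring
  have hd : (X * derivative (P (n + 1)) - C ((n : ℝ) + 1) * P (n + 1)).natDegree ≤ n := by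
    rw [natDegree_le_iff_coeff_eq_zero]
    intro m hm
    rw [coeff_sub, hc, coeff_C_mul]
    rcases (Nat.succ_le_of_lt hm).eq_or_lt with rfl | hlt
    · push_cast
      ring
    · rw [coeff_eq_zero_of_natDegree_lt (by rwa [hP.natDegree_eq])]
      ring
  have key := hP.map_mul_of_degree_le hd
  rw [coeff_sub, hc, coeff_C_mul, mul_sub, map_sub, mul_left_comm (P n) (C _), map_C_mul,
    hP.orthogonal _ _ n.succ_ne_self.symm] at key
  linarith

lemma map_mul_divX_self (hP : IsMonicOPS L P) (n : ℕ) : L (P n * divX (P n)) = 0 := by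
  have h := degree_divX_lt (hP.monic n).ne_zero
  rw [hP.degree_eq] at h
  exact hP.map_mul_eq_zero h

lemma natDegree_divX_succ (hP : IsMonicOPS L P) (n : ℕ) : (divX (P (n + 1))).natDegree = n := by
  rw [natDegree_divX_eq_natDegree_tsub_one, hP.natDegree_eq, Nat.add_sub_cancel]

lemma map_mul_divX_succ (hP : IsMonicOPS L P) (n : ℕ) :
    L (P n * divX (P (n + 1))) = L (P n * P n) := by
  rw [hP.map_mul_of_degree_le (hP.natDegree_divX_succ n).le, coeff_divX, hP.coeff_self, one_mul]

lemma map_mul_divX_divX (hP : IsMonicOPS L P) {m n : ℕ} (hmn : m ≤ n + 1) :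
    L (P n * divX (divX (P m))) = 0 := by
  by_cases h0 : divX (divX (P m)) = 0
  · rw [h0, mul_zero, map_zero]
  · refine hP.map_mul_eq_zero ((natDegree_lt_iff_degree_lt h0).mp ?_)
    have hne : divX (P m) ≠ 0 := fun h => h0 (by rw [h, divX_zero])
    have hm : m ≠ 0 := by
      rintro rfl
      rw [eq_C_of_natDegree_eq_zero (hP.natDegree_eq 0), divX_C] at hne
      exact hne rfl
    have hm1 : m ≠ 1 := by
      rintro rfl
      have h1 := hP.natDegree_divX_succ 0
      rw [eq_C_of_natDegree_eq_zero h1, divX_C] at h0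
      exact h0 rfl
    rw [natDegree_divX_eq_natDegree_tsub_one, natDegree_divX_eq_natDegree_tsub_one,
      hP.natDegree_eq]
    omega

end IsMonicOPS

/-! ### The semiclassical relations -/

/-- `L`, `L₁` and `L₂` behave like integration against a weight `w`, against `w / x` and against
`w / x²`, where `w' = (-3x² + a / x + t / x²) w` and `w` vanishes at the ends of the interval. -/
structure IsAirySemiclassical (a t : ℝ) (L L₁ L₂ : ℝ[X] →ₗ[ℝ] ℝ) : Prop where
  map_X_mul₁ : ∀ p, L₁ (X * p) = L p
  map_X_mul₂ : ∀ p, L₂ (X * p) = L₁ p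
  map_derivative : ∀ p, L (derivative p) = 3 * L (X ^ 2 * p) - a * L₁ p - t * L₂ p

lemma isAirySemiclassical_airyFunctional (a : ℝ) {t : ℝ} (ht : 0 < t) :
    IsAirySemiclassical a t (airyFunctional a ht) (airyFunctional (a - 1) ht)
      (airyFunctional (a - 2) ht) where
  map_X_mul₁ p := by rw [airyFunctional_X_mul, sub_add_cancel]
  map_X_mul₂ p := by rw [airyFunctional_X_mul, show a - 2 + 1 = a - 1 by ring]
  map_derivative := airyFunctional_derivative a ht

namespace IsAirySemiclassical

variable {a t : ℝ} {L L₁ L₂ : ℝ[X] →ₗ[ℝ] ℝ} {P : ℕ → ℝ[X]} {α β : ℕ → ℝ}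

lemma map₁_mul (hL : IsAirySemiclassical a t L L₁ L₂) (p q : ℝ[X]) :
    L₁ (p * q) = q.coeff 0 * L₁ p + L (p * divX q) := by
  have e : p * q = C (q.coeff 0) * p + X * (p * divX q) := by
    conv_lhs => rw [← divX_mul_X_add q]
    ring
  rw [e, map_add, map_C_mul, hL.map_X_mul₁]

lemma map₂_mul (hL : IsAirySemiclassical a t L L₁ L₂) (p q : ℝ[X]) :
    L₂ (p * q) = q.coeff 0 * L₂ p + q.coeff 1 * L₁ p + L (p * divX (divX q)) := by
  have e : p * q = C (q.coeff 0) * p + X * (p * divX q) := by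
    conv_lhs => rw [← divX_mul_X_add q]
    ring
  rw [e, map_add, map_C_mul, hL.map_X_mul₂, hL.map₁_mul, coeff_divX]
  ring

/-- Integration by parts for `P n ^ 2`. -/
lemma moment_sq (hL : IsAirySemiclassical a t L L₁ L₂) (hP : IsMonicOPS L P)
    (h : IsRecurrenceCoeffs P α β) (n : ℕ) :
    3 * (α n ^ 2 + β n + β (n + 1)) * L (P n * P n)
      = t * L₂ (P n * P n) + a * L₁ (P n * P n) := by
  have key := hL.map_derivative (P n * P n)
  rw [derivative_mul, map_add, mul_comm (derivative _), hP.map_mul_derivative_self,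
    hP.map_X_sq_mul_self h] at key
  linarith

/-- Integration by parts for `P (n + 1) * P n`. -/
lemma moment_succ (hL : IsAirySemiclassical a t L L₁ L₂) (hP : IsMonicOPS L P)
    (h : IsRecurrenceCoeffs P α β) (n : ℕ) :
    (3 * (α (n + 1) + α n) * β (n + 1) - (n + 1)) * L (P n * P n)
      = t * L₂ (P (n + 1) * P n) + a * L₁ (P (n + 1) * P n) := by
  have key := hL.map_derivative (P (n + 1) * P n)
  have h0 : L (P (n + 1) * derivative (P n)) = 0 := by
    refine hP.map_mul_eq_zero ((degree_derivative_le).trans_lt ?_)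
    rw [hP.degree_eq]
    exact_mod_cast n.lt_succ_self
  rw [derivative_mul, map_add, mul_comm (derivative _), hP.map_mul_derivative_succ, h0,
    hP.map_X_sq_mul_succ h, ← hP.beta_mul_norm h] at key
  linarith

/-- Integration by parts for `X * P n ^ 2`. -/
lemma moment_X_mul_sq (hL : IsAirySemiclassical a t L L₁ L₂) (hP : IsMonicOPS L P)
    (h : IsRecurrenceCoeffs P α β) (n : ℕ) :
    (3 * (α n * (α n ^ 2 + β n + β (n + 1)) + (α n + prevTerm α n) * β n
      + (α (n + 1) + α n) * β (n + 1)) - (2 * n + 1) - a) * L (P n * P n)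
      = t * L₁ (P n * P n) := by
  have key := hL.map_derivative (X * (P n * P n))
  have e : derivative (X * (P n * P n)) = P n * P n + (P n * (X * derivative (P n))
      + P n * (X * derivative (P n))) := by
    rw [derivative_mul, derivative_mul, derivative_X]; ring
  have e3 : X ^ 2 * (X * (P n * P n)) = X ^ 3 * (P n * P n) := by ring
  rw [e, e3, map_add, map_add, hP.map_mul_X_mul_derivative_self, hP.map_X_cube_mul_self h,
    hL.map_X_mul₁, hL.map_X_mul₂] at key
  linarith

/-- Integration by parts for `X * P (n + 1) * P n`. -/
lemma moment_X_mul_succ (hL : IsAirySemiclassical a t L L₁ L₂) (hP : IsMonicOPS L P)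
    (h : IsRecurrenceCoeffs P α β) (n : ℕ) :
    (3 * (α (n + 1) ^ 2 + α (n + 1) * α n + α n ^ 2 + β (n + 2) + β (n + 1) + β n) * β (n + 1)
      + (P (n + 1)).coeff n) * L (P n * P n) = t * L₁ (P (n + 1) * P n) := by
  have key := hL.map_derivative (X * (P (n + 1) * P n))
  have e : derivative (X * (P (n + 1) * P n)) = P (n + 1) * P n
      + (P n * (X * derivative (P (n + 1))) + P (n + 1) * (X * derivative (P n))) := by
    rw [derivative_mul, derivative_mul, derivative_X]; ring
  have e3 : X ^ 2 * (X * (P (n + 1) * P n)) = X ^ 3 * (P (n + 1) * P n) := by ring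
  have h0 : L (P (n + 1) * (X * derivative (P n))) = 0 := by
    refine hP.map_mul_eq_zero ?_
    have hlt := degree_derivative_lt (hP.monic n).ne_zero
    rw [hP.degree_eq] at hlt
    rw [degree_mul, degree_X, add_comm]
    exact_mod_cast WithBot.add_lt_add_right (by simp) hlt
  rw [e, e3, map_add, map_add, hP.map_mul_X_mul_derivative_succ, h0, hP.map_X_cube_mul_succ h,
    hL.map_X_mul₁, hL.map_X_mul₂, hP.orthogonal _ _ n.succ_ne_self, ← hP.beta_mul_norm h] at key
  linarith

end IsAirySemiclassical

namespace IsAirySemiclassical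

variable {a t : ℝ} {L L₁ L₂ : ℝ[X] →ₗ[ℝ] ℝ} {P : ℕ → ℝ[X]} {α β R r : ℕ → ℝ}

/-! ### The ladder relations -/

/-- The auxiliary quantity `t * ∫ P n * P (n - 1) * w / x`, normalised by the squared norm of
`P (n - 1)`. It vanishes for `n = 0`, where `P (-1) = 0`. -/
noncomputable def crossMoment (t : ℝ) (L L₁ : ℝ[X] →ₗ[ℝ] ℝ) (P : ℕ → ℝ[X]) : ℕ → ℝ
  | 0 => 0
  | n + 1 => t * L₁ (P (n + 1) * P n) / L (P n * P n)

lemma crossMoment_succ_mul (hP : IsMonicOPS L P) (hpos : ∀ p ≠ 0, 0 < L (p * p)) (n : ℕ) :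
    crossMoment t L L₁ P (n + 1) * L (P n * P n) = t * L₁ (P (n + 1) * P n) :=
  div_mul_cancel₀ _ (hP.norm_pos hpos n).ne'

/-- The combination `r n + r (n + 1) + α n * R n - a` is the normalised moment
`t * ∫ P n ^ 2 * w / x`. -/
lemma diagMoment (hL : IsAirySemiclassical a t L L₁ L₂) (hP : IsMonicOPS L P)
    (h : IsRecurrenceCoeffs P α β)
    (hR : ∀ n, R n = 3 * (α n ^ 2 + β n + β (n + 1)))
    (hr : ∀ n, r n = 3 * (α n + prevTerm α n) * β n - n) (n : ℕ) :
    (r n + r (n + 1) + α n * R n - a) * L (P n * P n) = t * L₁ (P n * P n) := by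
  rw [← hL.moment_X_mul_sq hP h, hr, hr, hR]
  simp only [prevTerm]
  push_cast
  ring

/-- Pairing the recurrence `x P n = P (n + 1) + α n P n + β n P (n - 1)` with `P n / x`. -/
lemma crossMoment_add (hL : IsAirySemiclassical a t L L₁ L₂) (hP : IsMonicOPS L P)
    (hpos : ∀ p ≠ 0, 0 < L (p * p)) (h : IsRecurrenceCoeffs P α β)
    (hR : ∀ n, R n = 3 * (α n ^ 2 + β n + β (n + 1)))
    (hr : ∀ n, r n = 3 * (α n + prevTerm α n) * β n - n) (n : ℕ) :
    crossMoment t L L₁ P (n + 1) + crossMoment t L L₁ P n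
      = t - α n * (r n + r (n + 1) + α n * R n - a) := by
  have hne := (hP.norm_pos hpos n).ne'
  have hS := hL.diagMoment hP h hR hr n
  have hX : L (P n * P n) = L₁ (P (n + 1) * P n) + α n * L₁ (P n * P n)
      + β n * L₁ (P n * prevTerm P n) := by
    have e : X * (P n * P n) = P n * (X * P n) := by ring
    rw [← hL.map_X_mul₁, e, IsMonicOPS.map_mul_recurrence L₁ h, mul_comm (P n) (P (n + 1))]
  have hprev : crossMoment t L L₁ P n * L (P n * P n)
      = t * (β n * L₁ (P n * prevTerm P n)) := by
    rcases n with _ | n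
    · rw [crossMoment, h.beta_zero]; ring
    · rw [prevTerm, ← hP.beta_mul_norm h]
      linear_combination β (n + 1) * crossMoment_succ_mul (t := t) (L₁ := L₁) hP hpos n
  refine mul_right_cancel₀ hne ?_
  linear_combination crossMoment_succ_mul (t := t) (L₁ := L₁) hP hpos n + hprev - t * hX
    + α n * hS

/-! Splitting off the Taylor polynomial at `0` of one factor, the moments of `P m * P n` against
`w / x` and `w / x ^ 2` factor through the moments of a single `P n` and the values and
derivatives of the polynomials at `0`. -/

lemma map₁_mul_self (hL : IsAirySemiclassical a t L L₁ L₂) (hP : IsMonicOPS L P) (n : ℕ) :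
    L₁ (P n * P n) = (P n).coeff 0 * L₁ (P n) := by
  rw [hL.map₁_mul, hP.map_mul_divX_self, add_zero]

lemma map₁_succ_mul (hL : IsAirySemiclassical a t L L₁ L₂) (hP : IsMonicOPS L P) (n : ℕ) :
    L₁ (P (n + 1) * P n) = (P n).coeff 0 * L₁ (P (n + 1)) := by
  have hd : (divX (P n)).degree < ((n + 1 : ℕ) : WithBot ℕ) := by
    refine degree_le_natDegree.trans_lt ?_
    rw [natDegree_divX_eq_natDegree_tsub_one, hP.natDegree_eq]
    exact_mod_cast (by omega)
  rw [hL.map₁_mul, hP.map_mul_eq_zero hd, add_zero]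

lemma map₁_mul_succ (hL : IsAirySemiclassical a t L L₁ L₂) (hP : IsMonicOPS L P) (n : ℕ) :
    L₁ (P (n + 1) * P n) = (P (n + 1)).coeff 0 * L₁ (P n) + L (P n * P n) := by
  rw [mul_comm, hL.map₁_mul, hP.map_mul_divX_succ]

lemma map₂_mul_self (hL : IsAirySemiclassical a t L L₁ L₂) (hP : IsMonicOPS L P) (n : ℕ) :
    L₂ (P n * P n) = (P n).coeff 0 * L₂ (P n) + (P n).coeff 1 * L₁ (P n) := by
  rw [hL.map₂_mul, hP.map_mul_divX_divX n.le_succ, add_zero]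

lemma map₂_succ_mul (hL : IsAirySemiclassical a t L L₁ L₂) (hP : IsMonicOPS L P) (n : ℕ) :
    L₂ (P (n + 1) * P n) = (P n).coeff 0 * L₂ (P (n + 1)) + (P n).coeff 1 * L₁ (P (n + 1)) := by
  rw [hL.map₂_mul, hP.map_mul_divX_divX (by omega), add_zero]

lemma map₂_mul_succ (hL : IsAirySemiclassical a t L L₁ L₂) (hP : IsMonicOPS L P) (n : ℕ) :
    L₂ (P (n + 1) * P n) = (P (n + 1)).coeff 0 * L₂ (P n) + (P (n + 1)).coeff 1 * L₁ (P n) := by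
  rw [mul_comm, hL.map₂_mul, hP.map_mul_divX_divX le_rfl, add_zero]

/-- The relation between the cross moment and the diagonal moments: both sides are
`t ^ 2 * P n (0) * P (n + 1) (0) * Q n * Q (n + 1)` up to normalisation, where
`Q n = ∫ P n * w / x`. -/
lemma crossMoment_mul_sub (hL : IsAirySemiclassical a t L L₁ L₂) (hP : IsMonicOPS L P)
    (hpos : ∀ p ≠ 0, 0 < L (p * p)) (h : IsRecurrenceCoeffs P α β)
    (hR : ∀ n, R n = 3 * (α n ^ 2 + β n + β (n + 1)))
    (hr : ∀ n, r n = 3 * (α n + prevTerm α n) * β n - n) (n : ℕ) :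
    crossMoment t L L₁ P (n + 1) * (crossMoment t L L₁ P (n + 1) - t)
      = β (n + 1) * (r (n + 1) + r (n + 2) + α (n + 1) * R (n + 1) - a)
        * (r n + r (n + 1) + α n * R n - a) := by
  have hne := (hP.norm_pos hpos n).ne'
  have hc := crossMoment_succ_mul (t := t) (L₁ := L₁) hP hpos n
  have hc' := hc
  rw [hL.map₁_succ_mul hP] at hc
  rw [hL.map₁_mul_succ hP] at hc'
  have hS := hL.diagMoment hP h hR hr (n + 1)
  have hS' := hL.diagMoment hP h hR hr n
  rw [hL.map₁_mul_self hP, ← hP.beta_mul_norm h] at hS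
  rw [hL.map₁_mul_self hP] at hS'
  refine mul_right_cancel₀ (mul_ne_zero hne hne) ?_
  linear_combination ((crossMoment t L L₁ P (n + 1) - t) * L (P n * P n)) * hc
    + (t * ((P n).coeff 0 * L₁ (P (n + 1)))) * hc'
    - ((r n + r (n + 1) + α n * R n - a) * L (P n * P n)) * hS
    - (t * ((P (n + 1)).coeff 0 * L₁ (P (n + 1)))) * hS'

/-- The bilinear companion of `crossMoment_mul_sub`, which also involves the moments against
`w / x ^ 2`. -/
lemma two_mul_sub_mul_crossMoment (hL : IsAirySemiclassical a t L L₁ L₂) (hP : IsMonicOPS L P)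
    (hpos : ∀ p ≠ 0, 0 < L (p * p)) (h : IsRecurrenceCoeffs P α β)
    (hR : ∀ n, R n = 3 * (α n ^ 2 + β n + β (n + 1)))
    (hr : ∀ n, r n = 3 * (α n + prevTerm α n) * β n - n) (n : ℕ) :
    (2 * r (n + 1) - a) * crossMoment t L L₁ P (n + 1) - t * r (n + 1)
      = β (n + 1) * (R (n + 1) * (r n + r (n + 1) + α n * R n - a)
        + R n * (r (n + 1) + r (n + 2) + α (n + 1) * R (n + 1) - a)) := by
  have hne := (hP.norm_pos hpos n).ne'
  have hβ := hP.beta_mul_norm h n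
  have hc := crossMoment_succ_mul (t := t) (L₁ := L₁) hP hpos n
  have hS := hL.diagMoment hP h hR hr (n + 1)
  have hS' := hL.diagMoment hP h hR hr n
  have hRn := hL.moment_sq hP h (n + 1)
  have hRn' := hL.moment_sq hP h n
  have hrn := hL.moment_succ hP h n
  have hrn' : 3 * (α (n + 1) + α n) * β (n + 1) - (n + 1) = r (n + 1) := by
    rw [hr, prevTerm]; push_cast; rfl
  have h₁ := (hL.map₁_succ_mul hP n).symm.trans (hL.map₁_mul_succ hP n)
  have h₂ := hL.map₂_succ_mul hP n
  have h₂' := hL.map₂_mul_succ hP n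
  rw [hL.map₁_succ_mul hP] at hc
  rw [hL.map₁_mul_self hP, ← hβ] at hS
  rw [hL.map₁_mul_self hP] at hS'
  rw [← hR, hL.map₁_mul_self hP, hL.map₂_mul_self hP, ← hβ] at hRn
  rw [← hR, hL.map₁_mul_self hP, hL.map₂_mul_self hP] at hRn'
  rw [hrn', hL.map₁_succ_mul hP] at hrn
  refine mul_right_cancel₀ (mul_ne_zero hne hne) ?_
  generalize crossMoment t L L₁ P (n + 1) = c at *
  generalize r (n + 1) + r (n + 2) + α (n + 1) * R (n + 1) - a = S at *
  generalize r n + r (n + 1) + α n * R n - a = S' at *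
  generalize L (P n * P n) = H at *
  generalize L₂ (P (n + 1) * P n) = W at *
  generalize (P n).coeff 0 = q at *
  generalize (P n).coeff 1 = q' at *
  generalize (P (n + 1)).coeff 0 = p at *
  generalize (P (n + 1)).coeff 1 = p' at *
  generalize L₁ (P n) = U at *
  generalize L₁ (P (n + 1)) = Q at *
  generalize L₂ (P n) = V at *
  generalize L₂ (P (n + 1)) = T at *
  linear_combination (2 * c * H - t * H) * hrn + (2 * (t * W + a * (q * Q)) - a * H) * hc
    - (S' * H) * hRn - (t * (p * T + p' * Q) + a * (p * Q)) * hS'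
    - (S * (β (n + 1) * H)) * hRn' - (t * (q * V + q' * U) + a * (q * U)) * hS
    + (t ^ 2 * W + 2 * a * t * (q * Q)) * h₁ + t ^ 2 * (p * U) * h₂ + t ^ 2 * (q * Q) * h₂'

/-- Integration by parts for `x * P (n + 1) * P n`, with the subleading coefficients of the
`P n` eliminated by taking differences in `n`. -/
lemma crossMoment_sub (hL : IsAirySemiclassical a t L L₁ L₂) (hP : IsMonicOPS L P)
    (hpos : ∀ p ≠ 0, 0 < L (p * p)) (h : IsRecurrenceCoeffs P α β)
    (hR : ∀ n, R n = 3 * (α n ^ 2 + β n + β (n + 1))) (n : ℕ) :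
    crossMoment t L L₁ P (n + 1) - crossMoment t L L₁ P n + α n
      = β (n + 1) * (3 * α (n + 1) * α n + R (n + 1) + R n) - 3 * β (n + 1) ^ 2
        - (β n * (3 * α n * prevTerm α n + R n + prevTerm R n) - 3 * β n ^ 2) := by
  have key : ∀ m, crossMoment t L L₁ P (m + 1) = β (m + 1) * (3 * α (m + 1) * α m + R (m + 1)
      + R m) - 3 * β (m + 1) ^ 2 + (P (m + 1)).coeff m := fun m => by
    refine mul_right_cancel₀ (hP.norm_pos hpos m).ne' ?_
    rw [crossMoment_succ_mul hP hpos, ← hL.moment_X_mul_succ hP h, hR, hR]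
    ring
  rcases n with _ | n
  · rw [key, hP.coeff_one_zero h, h.beta_zero, crossMoment]
    ring
  · rw [key, key, hP.coeff_succ_sub h, prevTerm, prevTerm]
    ring

/-- The two difference equations, obtained by eliminating the cross moment from the ladder
relations. -/
lemma difference_equations (hL : IsAirySemiclassical a t L L₁ L₂) (hP : IsMonicOPS L P)
    (hpos : ∀ p ≠ 0, 0 < L (p * p)) (h : IsRecurrenceCoeffs P α β)
    (hR : ∀ n, R n = 3 * (α n ^ 2 + β n + β (n + 1)))
    (hr : ∀ n, r n = 3 * (α n + prevTerm α n) * β n - n) (n : ℕ) :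
    ((r n + r (n + 1) + α n * R n - a) * β n * prevTerm R n
        + (prevTerm r n + r n + prevTerm α n * prevTerm R n - a) * β n * R n + t * r n)
      * ((r n + r (n + 1) + α n * R n - a) * β n * prevTerm R n
        + (prevTerm r n + r n + prevTerm α n * prevTerm R n - a) * β n * R n
        - t * r n + a * t)
      = β n * (2 * r n - a) ^ 2 * (r n + r (n + 1) + α n * R n - a)
        * (prevTerm r n + r n + prevTerm α n * prevTerm R n - a)
    ∧ 2 * (r n + r (n + 1) + α n * R n - a) * β n * prevTerm R n
        + 2 * (prevTerm r n + r n + prevTerm α n * prevTerm R n - a) * β n * R n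
        + 2 * t * r n
        + (2 * r n - a) * (α n * (r n + r (n + 1) + α n * R n - a - 1)
          + 3 * β n ^ 2 - 3 * β (n + 1) ^ 2 - t)
      = (2 * r n - a) * (β n * (3 * α n * prevTerm α n + R n + prevTerm R n)
        - β (n + 1) * (3 * α (n + 1) * α n + R (n + 1) + R n)) := by
  have hadd := hL.crossMoment_add hP hpos h hR hr n
  have hsub := hL.crossMoment_sub hP hpos h hR n
  -- At `n = 0` both relations hold trivially, since `β 0`, `r 0` and the cross moment vanish.
  have hquad : crossMoment t L L₁ P n * (crossMoment t L L₁ P n - t)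
      = β n * (r n + r (n + 1) + α n * R n - a)
        * (prevTerm r n + r n + prevTerm α n * prevTerm R n - a) := by
    rcases n with _ | n
    · rw [h.beta_zero, crossMoment]; ring
    · exact hL.crossMoment_mul_sub hP hpos h hR hr n
  have hbil : (2 * r n - a) * crossMoment t L L₁ P n - t * r n
      = β n * (R n * (prevTerm r n + r n + prevTerm α n * prevTerm R n - a)
        + prevTerm R n * (r n + r (n + 1) + α n * R n - a)) := by
    rcases n with _ | n
    · have hr0 : r 0 = 0 := by rw [hr, h.beta_zero]; simp
      rw [h.beta_zero, crossMoment, hr0]; ring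
    · exact hL.two_mul_sub_mul_crossMoment hP hpos h hR hr n
  generalize prevTerm r n + r n + prevTerm α n * prevTerm R n - a = S' at *
  generalize r n + r (n + 1) + α n * R n - a = S at *
  generalize crossMoment t L L₁ P n = c at *
  constructor
  · linear_combination (2 * r n - a) ^ 2 * hquad
      - (S * β n * prevTerm R n + S' * β n * R n - t * r n + a * t + (2 * r n - a) * c) * hbil
  · linear_combination -2 * hbil + (2 * r n - a) * (hadd - hsub)

end IsAirySemiclassical

theorem theorem2p3 (lam t : ℝ) (hlam : -1 < lam) (ht : 0 < t) :
    (∃! P : ℕ → ℝ[X], IsMonicAiryOPS lam t P) ∧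
    ∀ P : ℕ → ℝ[X], IsMonicAiryOPS lam t P →
      (∀ n, 0 < airyPairing lam t (P n) (P n)) ∧
      (∃! c : (ℕ → ℝ) × (ℕ → ℝ), IsRecurrenceCoeffs P c.1 c.2) ∧
      ∀ α β : ℕ → ℝ, IsRecurrenceCoeffs P α β →
        ∀ R r : ℕ → ℝ,
          (∀ n, R n = 3 * (α n ^ 2 + β n + β (n + 1))) →
          (∀ n, r n = 3 * (α n + prevTerm α n) * β n - n) →
          ∀ n : ℕ,
            ((r n + r (n + 1) + α n * R n - lam) * β n * prevTerm R n
                + (prevTerm r n + r n + prevTerm α n * prevTerm R n - lam) * β n * R n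
                + t * r n)
              * ((r n + r (n + 1) + α n * R n - lam) * β n * prevTerm R n
                + (prevTerm r n + r n + prevTerm α n * prevTerm R n - lam) * β n * R n
                - t * r n + lam * t)
              = β n * (2 * r n - lam) ^ 2 * (r n + r (n + 1) + α n * R n - lam)
                * (prevTerm r n + r n + prevTerm α n * prevTerm R n - lam)
            ∧
            2 * (r n + r (n + 1) + α n * R n - lam) * β n * prevTerm R n
                + 2 * (prevTerm r n + r n + prevTerm α n * prevTerm R n - lam) * β n * R n
                + 2 * t * r n
                + (2 * r n - lam) * (α n * (r n + r (n + 1) + α n * R n - lam - 1)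
                  + 3 * β n ^ 2 - 3 * β (n + 1) ^ 2 - t)
              = (2 * r n - lam) * (β n * (3 * α n * prevTerm α n + R n + prevTerm R n)
                - β (n + 1) * (3 * α (n + 1) * α n + R (n + 1) + R n)) := by
  have hiff : ∀ P : ℕ → ℝ[X], IsMonicAiryOPS lam t P ↔ IsMonicOPS (airyFunctional lam ht) P :=
    fun P => by
      constructor
      · rintro ⟨h1, h2, h3⟩
        exact ⟨h1, h2, fun m n hmn => by rw [← airyPairing_eq, h3 m n hmn]⟩
      · rintro ⟨h1, h2, h3⟩
        exact ⟨h1, h2, fun m n hmn => by rw [airyPairing_eq lam ht, h3 m n hmn]⟩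
  have hpos : ∀ p : ℝ[X], p ≠ 0 → 0 < airyFunctional lam ht (p * p) :=
    fun p hp => airyFunctional_mul_self_pos lam ht hp
  refine ⟨?_, fun P hP => ?_⟩
  · simp only [hiff]
    exact IsMonicOPS.existsUnique hpos
  · rw [hiff] at hP
    refine ⟨fun n => ?_, hP.existsUnique_isRecurrenceCoeffs hpos, fun α β h R r hR hr n => ?_⟩
    · rw [airyPairing_eq lam ht]
      exact hP.norm_pos hpos n
    · exact (isAirySemiclassical_airyFunctional lam ht).difference_equations hP hpos h hR hr n
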